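/- For complex $|q|<1$ let $$A(q)=q^{1/5}(q;q)_\infty^{-3/5}\sum_{n\in\mathbb Z}(-1)^nq^{(5n^2-3n)/2},\qquad B(q)=(q;q)_\infty^{-3/5}\sum_{n\in\mathbb Z}(-1)^nq^{(5n^2-n)/2},$$ where $(q;q)_\infty=\prod_{n\ge1}(1-q^n)$ and $(q;q)_\infty^{-3/5}$ is the analytic branch on the unit disc that equals $1$ at $q=0$. For power series put $$\pi\Bigl(\sum_{n\ge0}c_nq^n\Bigr)=\sum_{n\ge0}c_nq^{n/5},\qquad \Omega_{5,m}\Bigl(\sum_{n\ge0}c_nq^n\Bigr)=\sum_{n\ge0}c_{5n+m}q^n\quad(0\le m\le4).$$ Let $\mathcal F_n$ be the set of $\vec n=(n_1,\dots,n_5)\in\mathbb Z_{\ge0}^5$ with $n_1+\cdots+n_5=n$, and let $f(\vec n)=5n_1+4n_2+3n_3+2n_4+n_5$, $g(\vec n)=n_2+2n_3+3n_4+4n_5$. For $d\ge0$ let $\mathcal B_d$ be the $(5d+1)\times(d+1)$ integer matrix with entries, for $0\le r\le5d$ and $0\le k\le d$, $$(\mathcal B_d)_{r,k}=\sum_{\substack{\vec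 j\in\mathcal F_{d-k},\ \vec k\in\mathcal F_k\\ f(\vec j)+g(\vec k)=5d-r\\ g(\vec j)+f(\vec k)=r}}(-1)^{k_2+k_4}\,2^{j_4+k_4}\,3^{j_2+k_2}\,4^{j_3+k_3}\binom{k}{\vec k}\binom{d-k}{\vec j},$$ where $\binom{n}{\vec n}=n!/(n_1!\cdots n_5!)$. **Theorem.** Let $d\ge0$ and $a_0,\dots,a_d\in\mathbb C$, let $F(q)=\sum_{k=0}^da_kA^{5k}(q)B^{5(d-k)}(q)$, and let $(b_0,\dots,b_{5d})^T=\mathcal B_d(a_0,\dots,a_d)^T$. Then $F$ has a power series expansion in $q$ converging to $F(q)$ for $|q|<1$. For every $|q|<1$ and every choice of the fifth root $q^{1/5}$ (used consistently in $A(q)$ and elsewhere), $$\pi(F)=\sum_{r=0}^{5d}b_rA^r(q)B^{5d-r}(q),$$ and, for $0\le m\le4$ (with $q\ne0$ if $m\neq0$), $$\Omega_{5,m}(F)=q^{-m/5}\sum_{k=0}^{d-\chi(m)}b_{5k+m}A^{5k+m}(q)B^{5d-5k-m}(q),$$ where $\chi$ is the principal character modulo $5$ (an empty sum is $0$) and the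 series defining $\pi(F)$ and $\Omega_{5,m}(F)$ converge. In particular, let $F$ be regarded as a function of $\tau$ in the upper half-plane through $q=e^{2\pi i\tau}$, and let $T_5F=\sum_{j=0}^{4}F|_d\begin{pmatrix}1&j\\0&5\end{pmatrix}$, that is, $(T_5F)(\tau)=\tfrac15\sum_{j=0}^4F\bigl(\tfrac{\tau+j}5\bigr)$, be the Hecke operator of weight $d$ and level divisible by $5$. Then $$T_5F=\Omega_{5,0}(F)=\sum_{k=0}^{d}b_{5k}A^{5k}B^{5(d-k)},$$ so $T_5$ acts on coefficient vectors by the $(d+1)\times(d+1)$ matrix consisting of the rows $0,5,\dots,5d$ of $\mathcal B_d$. -/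

import Mathlib

open scoped PowerSeries

noncomputable section

namespace Quintic

/-! Fractional powers of `q` are handled through a chosen fifth root: everywhere below, `x` stands
for `q^{1/5}`, so that `q = x ^ 5`. The results are stated for every `x` in the open unit disc,
that is, for every `q` with `|q| < 1` and every choice of its fifth root. -/

/-- The Euler product `(q;q)_∞ = ∏_{n ≥ 1} (1 - q^n)`. -/
def eulerProd (q : ℂ) : ℂ := ∏' n : ℕ, (1 - q ^ (n + 1))

/-- The power `(q;q)_∞^s` for `|q| < 1`: the branch which is analytic on the unit disc and equal
to `1` at `q = 0`, i.e. `exp (s ∑_{n ≥ 1} log (1 - q^n))`. -/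
def eulerPow (s q : ℂ) : ℂ := Complex.exp (s * ∑' n : ℕ, Complex.log (1 - q ^ (n + 1)))

/-- The case `s = 1` gives the Euler product itself. -/
theorem eulerPow_one {q : ℂ} (hq : ‖q‖ < 1) : eulerPow 1 q = eulerProd q := by
  have hs : Summable fun n : ℕ => -q ^ (n + 1) :=
    Summable.neg (f := fun n : ℕ => q ^ (n + 1))
      ((summable_nat_add_iff (f := fun n : ℕ => q ^ n) 1).2 (summable_geometric_of_norm_lt_one hq))
  have hne : ∀ n : ℕ, 1 - q ^ (n + 1) ≠ 0 := by
    intro n h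
    have h1 : ‖q ^ (n + 1)‖ = 1 := by rw [← sub_eq_zero.1 h, norm_one]
    rw [norm_pow] at h1
    exact absurd h1 (pow_lt_one₀ (norm_nonneg q) hq (Nat.succ_ne_zero n)).ne
  have hl : Summable fun n : ℕ => Complex.log (1 - q ^ (n + 1)) := by
    simpa [sub_eq_add_neg] using Complex.summable_log_one_add_of_summable hs
  rw [eulerPow, eulerProd, one_mul]
  exact Complex.cexp_tsum_eq_tprod hne hl

/-- `A(q) = q^{1/5} (q;q)_∞^{-3/5} ∑_{n ∈ ℤ} (-1)^n q^{(5n² - 3n)/2}`, with `q = x ^ 5` and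
`q^{1/5} = x`. The division in the exponent is exact and the exponents are nonnegative. -/
def thetaA (x : ℂ) : ℂ :=
  x * eulerPow (-(3 / 5)) (x ^ 5) * ∑' n : ℤ, (-1 : ℂ) ^ n * (x ^ 5) ^ ((5 * n ^ 2 - 3 * n) / 2)

/-- `B(q) = (q;q)_∞^{-3/5} ∑_{n ∈ ℤ} (-1)^n q^{(5n² - n)/2}`, with `q = x ^ 5`.
The division in the exponent is exact and the exponents are nonnegative. -/
def thetaB (x : ℂ) : ℂ :=
  eulerPow (-(3 / 5)) (x ^ 5) * ∑' n : ℤ, (-1 : ℂ) ^ n * (x ^ 5) ^ ((5 * n ^ 2 - n) / 2)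

/-- `∑_{k=0}^d a_k A^{5k}(q) B^{5(d-k)}(q)`, with `q = x ^ 5`: the homogeneous polynomial of
degree `d` in `A^5` and `B^5` with coefficient vector `a`. -/
def form (d : ℕ) (a : Fin (d + 1) → ℂ) (x : ℂ) : ℂ :=
  ∑ k : Fin (d + 1), a k * thetaA x ^ (5 * (k : ℕ)) * thetaB x ^ (5 * (d - (k : ℕ)))

/-- The power series `f` converges at `z`, with sum `w`. -/
def SumsTo (f : ℂ⟦X⟧) (z w : ℂ) : Prop := HasSum (fun n : ℕ => PowerSeries.coeff n f * z ^ n) w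

/-- The multisection operator `Ω_{5,m} (∑ a_n q^n) = ∑ a_{5n+m} q^n`. -/
def multisection (m : ℕ) (f : ℂ⟦X⟧) : ℂ⟦X⟧ :=
  PowerSeries.mk fun n => PowerSeries.coeff (5 * n + m) f

/-- `𝓕_n`: the tuples of five nonnegative integers with sum `n`
(`n₁, …, n₅` are the entries `v 0, …, v 4`). -/
def compositions (n : ℕ) : Finset (Fin 5 → ℕ) := Finset.piAntidiag Finset.univ n

/-- `f(n₁, …, n₅) = 5n₁ + 4n₂ + 3n₃ + 2n₄ + n₅`. -/
def fWeight (v : Fin 5 → ℕ) : ℕ := 5 * v 0 + 4 * v 1 + 3 * v 2 + 2 * v 3 + v 4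

/-- `g(n₁, …, n₅) = n₂ + 2n₃ + 3n₄ + 4n₅`. -/
def gWeight (v : Fin 5 → ℕ) : ℕ := v 1 + 2 * v 2 + 3 * v 3 + 4 * v 4

/-- The pentamidiation array `𝓑_d`, an integer matrix with rows `0, …, 5d` and columns
`0, …, d`. `Nat.multinomial Finset.univ v` is `(v₀ + ⋯ + v₄)! / (v₀! ⋯ v₄!)`. -/
def pentamidiation (d : ℕ) : Matrix (Fin (5 * d + 1)) (Fin (d + 1)) ℤ :=
  Matrix.of fun r k =>
    ∑ p ∈ (compositions (d - (k : ℕ)) ×ˢ compositions (k : ℕ)).filter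
        (fun p => fWeight p.1 + gWeight p.2 = 5 * d - (r : ℕ) ∧
          gWeight p.1 + fWeight p.2 = (r : ℕ)),
      (-1) ^ (p.2 1 + p.2 3) * 2 ^ (p.1 3 + p.2 3) * 3 ^ (p.1 1 + p.2 1) * 4 ^ (p.1 2 + p.2 2) *
        (Nat.multinomial Finset.univ p.2 : ℤ) * (Nat.multinomial Finset.univ p.1 : ℤ)

/-- The vector `(b_0, …, b_{5d})ᵀ = 𝓑_d (a_0, …, a_d)ᵀ`. -/
def pentamidiate (d : ℕ) (a : Fin (d + 1) → ℂ) : Fin (5 * d + 1) → ℂ :=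
  ((pentamidiation d).map (Int.cast : ℤ → ℂ)).mulVec a

/-- The values of the principal Dirichlet character modulo five. -/
def chi (m : ℕ) : ℕ := if Nat.Coprime m 5 then 1 else 0

/-- For `0 ≤ m ≤ 4` and `0 ≤ k ≤ d - χ(m)`, the index `5k + m` is at most `5d`. -/
theorem index_lt (d : ℕ) (m : Fin 5) (k : Fin (d + 1 - chi m)) :
    5 * (k : ℕ) + (m : ℕ) < 5 * d + 1 := by
  have h : ∀ m : Fin 5, chi m = if (m : ℕ) = 0 then 0 else 1 := by decide
  have hk := k.isLt
  have hm := m.isLt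
  have h' := h m
  split_ifs at h' <;> omega

/-- The `(d+1) × (d+1)` matrix consisting of the rows `0, 5, 10, …, 5d` of `𝓑_d`. -/
def heckeMatrix (d : ℕ) : Matrix (Fin (d + 1)) (Fin (d + 1)) ℤ :=
  (pentamidiation d).submatrix (fun k => ⟨5 * (k : ℕ), by omega⟩) id

/-- The matrix with rows `(1, j)` and `(0, 5)`. -/
def heckeRep (j : Fin 5) : GL (Fin 2) ℝ :=
  Matrix.GeneralLinearGroup.mkOfDetNeZero !![1, ((j : ℕ) : ℝ); 0, 5] (by simp [Matrix.det_fin_two])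

open scoped ModularForm in
/-- The Hecke operator `T_5` in weight `k` and level divisible by `5`: the sum of the weight-`k`
slash actions of the five coset representatives `(1, j; 0, 5)`, `0 ≤ j ≤ 4`. -/
def heckeT5 (k : ℤ) (F : UpperHalfPlane → ℂ) : UpperHalfPlane → ℂ :=
  ∑ j : Fin 5, F ∣[k] heckeRep j

/-- The fifth root `exp (2πiτ/5)` of `q = exp (2πiτ)`. -/
def qRoot (τ : UpperHalfPlane) : ℂ := Function.Periodic.qParam 5 (τ : ℂ)

end Quintic

end

open scoped PowerSeries
open Filter Topology

namespace Quintic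

/-! Everything rests on two identities expressing `A^5` and `B^5` at `q` as quintic forms in `A` and
`B` at `q^5` (`pow_five_eq`). Let `ζ` be a primitive fifth root of unity and `φ = ζ^2 + ζ^3`. The
Jacobi triple product at `z = ζ`, split by the residue of the summation index modulo 5, shows that
the linear form `sumB (x^5) + φ x sumA (x^5)` is a product of three twisted Euler products
(`sumB_add_mul_sumA`).

Multiply this over `x, ζx, …, ζ^4 x`. The linear forms collapse to `sumB^5 + φ^5 x^5 sumA^5`, while
`prod_twistedProd` turns the products into fifth powers of the same products at `x^5`, that is, into
the fifth power of the linear form at `x^5`. After normalization, `(B(q^5) + φ A(q^5))^5 = B(q)^5 +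
φ^5 A(q)^5`. The two conjugate values of `φ` give two linear equations for `A(q)^5` and `B(q)^5`,
solved in `solve_quintic_pair`.

The multinomial theorem then makes the columns of the array the coefficients of products of powers
of these two forms (`sum_pentamidiation_mul`), which expands `F(q^{1/5})`. Under `x ↦ ζx`, `A` picks
up `ζ` and `B` is fixed, so averaging over fifth roots of unity selects the indices in one residue
class. The Hecke operator is this average for the class of `0`. -/

/-! ### Euler products, finite and infinite. -/

/-- The product `∏_{n ≥ 1} (1 - c q^n)`. -/
noncomputable def twistedProd (c q : ℂ) : ℂ := ∏' n : ℕ, (1 - c * q ^ (n + 1))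

theorem twistedProd_one (q : ℂ) : twistedProd 1 q = eulerProd q := by
  simp [twistedProd, eulerProd]

theorem multipliable_twisted (c : ℂ) {q : ℂ} (hq : ‖q‖ < 1) :
    Multipliable fun n : ℕ => 1 - c * q ^ (n + 1) := by
  have hs : Summable fun n : ℕ => ‖-(c * q ^ (n + 1))‖ := by
    simp only [norm_neg, norm_mul, norm_pow]
    exact ((summable_nat_add_iff 1).2
      (summable_geometric_of_lt_one (norm_nonneg q) hq)).mul_left _
  simpa [sub_eq_add_neg] using multipliable_one_add_of_summable hs

theorem tendsto_prod_twisted (c : ℂ) {q : ℂ} (hq : ‖q‖ < 1) :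
    Tendsto (fun N : ℕ => ∏ i ∈ Finset.range N, (1 - c * q ^ (i + 1))) atTop
      (𝓝 (twistedProd c q)) :=
  (multipliable_twisted c hq).hasProd.tendsto_prod_nat

theorem eulerProd_ne_zero {q : ℂ} (hq : ‖q‖ < 1) : eulerProd q ≠ 0 := by
  rw [← eulerPow_one hq]
  exact Complex.exp_ne_zero _

/-- The finite Euler product `∏_{1 ≤ i ≤ n} (1 - q^i)`. -/
def qFactor (q : ℂ) (n : ℕ) : ℂ := ∏ i ∈ Finset.range n, (1 - q ^ (i + 1))

theorem qFactor_succ (q : ℂ) (n : ℕ) : qFactor q (n + 1) = qFactor q n * (1 - q ^ (n + 1)) :=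
  Finset.prod_range_succ _ _

theorem qFactor_ne_zero {q : ℂ} (hq : ‖q‖ < 1) (n : ℕ) : qFactor q n ≠ 0 := by
  refine Finset.prod_ne_zero_iff.2 fun i _ h => ?_
  have h1 : ‖q ^ (i + 1)‖ = 1 := by rw [← sub_eq_zero.1 h, norm_one]
  rw [norm_pow] at h1
  exact absurd h1 (pow_lt_one₀ (norm_nonneg q) hq (Nat.succ_ne_zero i)).ne

theorem tendsto_qFactor {q : ℂ} (hq : ‖q‖ < 1) :
    Tendsto (qFactor q) atTop (𝓝 (eulerProd q)) := by
  simpa [twistedProd_one, qFactor] using! tendsto_prod_twisted 1 hq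

/-! ### Gaussian binomials and the finite triple product. -/

/-- The Gaussian binomial coefficients. -/
def gaussBinom (q : ℂ) : ℕ → ℕ → ℂ
  | _, 0 => 1
  | 0, _ + 1 => 0
  | n + 1, k + 1 => gaussBinom q n (k + 1) + q ^ (n - k) * gaussBinom q n k

@[simp] theorem gaussBinom_zero_right (q : ℂ) (n : ℕ) : gaussBinom q n 0 = 1 := by
  cases n <;> rfl

theorem gaussBinom_succ_succ (q : ℂ) (n k : ℕ) : gaussBinom q (n + 1) (k + 1) =
    gaussBinom q n (k + 1) + q ^ (n - k) * gaussBinom q n k := rfl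

theorem gaussBinom_eq_zero (q : ℂ) {n k : ℕ} (h : n < k) : gaussBinom q n k = 0 := by
  induction n generalizing k with
  | zero => obtain ⟨k, rfl⟩ := Nat.exists_eq_succ_of_ne_zero h.ne'; rfl
  | succ n ih =>
    obtain ⟨k, rfl⟩ := Nat.exists_eq_succ_of_ne_zero (by omega : k ≠ 0)
    rw [Nat.succ_eq_add_one, gaussBinom_succ_succ, ih (by omega), ih (by omega)]
    simp

theorem gaussBinom_mul_qFactor (q : ℂ) (j k : ℕ) :
    gaussBinom q (j + k) k * (qFactor q j * qFactor q k) = qFactor q (j + k) := by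
  induction h : j + k generalizing j k with
  | zero =>
    obtain ⟨rfl, rfl⟩ : j = 0 ∧ k = 0 := by omega
    simp [qFactor]
  | succ s ih =>
    rcases k with _ | k
    · simp only [Nat.add_zero] at h
      simp [qFactor, h]
    rcases j with _ | j
    · obtain rfl : k = s := by omega
      have := ih 0 k (by omega)
      rw [gaussBinom_succ_succ, gaussBinom_eq_zero q (Nat.lt_succ_self k), qFactor_succ]
      simp only [Nat.sub_self, pow_zero, one_mul, zero_add]
      linear_combination (1 - q ^ (k + 1)) * this
    · have h1 := ih j (k + 1) (by omega)
      have h2 := ih (j + 1) k (by omega)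
      rw [gaussBinom_succ_succ, qFactor_succ q s, (by omega : s - k = j + 1)]
      rw [qFactor_succ] at h1 h2 ⊢
      rw [qFactor_succ q k]
      have hs : q ^ (s + 1) = q ^ (j + 1) * q ^ (k + 1) := by rw [← pow_add]; congr 1; omega
      rw [hs]
      -- Uses `1 - q^(j+k+2) = (1 - q^(j+1)) + q^(j+1) (1 - q^(k+1))`.
      linear_combination (1 - q ^ (j + 1)) * h1 + q ^ (j + 1) * (1 - q ^ (k + 1)) * h2

/-- The `q`-binomial theorem. -/
theorem prod_one_add_mul_pow (q t : ℂ) (n : ℕ) :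
    ∏ i ∈ Finset.range n, (1 + t * q ^ i) =
      ∑ k ∈ Finset.range (n + 1), gaussBinom q n k * q ^ k.choose 2 * t ^ k := by
  induction n with
  | zero => simp
  | succ n ih =>
    rw [Finset.prod_range_succ, ih, Finset.sum_range_succ' _ (n + 1)]
    have h : ∀ k ∈ Finset.range (n + 1),
        gaussBinom q (n + 1) (k + 1) * q ^ (k + 1).choose 2 * t ^ (k + 1) =
          gaussBinom q n (k + 1) * q ^ (k + 1).choose 2 * t ^ (k + 1) +
            gaussBinom q n k * q ^ k.choose 2 * t ^ k * (t * q ^ n) := by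
      intro k hk
      have hn : q ^ n = q ^ (n - k) * q ^ k := by
        rw [← pow_add]; congr 1; have := Finset.mem_range.1 hk; omega
      have hc : (k + 1).choose 2 = k + k.choose 2 := by
        rw [Nat.choose_succ_succ' k 1, Nat.choose_one_right]
      rw [gaussBinom_succ_succ, hn, hc]
      ring
    rw [Finset.sum_congr rfl h, Finset.sum_add_distrib, ← Finset.sum_mul]
    have h0 := Finset.sum_range_succ' (fun k => gaussBinom q n k * q ^ k.choose 2 * t ^ k) (n + 1)
    rw [Finset.sum_range_succ, gaussBinom_eq_zero q (Nat.lt_succ_self n)] at h0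
    simp only [zero_mul, add_zero] at h0
    simp only [gaussBinom_zero_right] at h0 ⊢
    linear_combination h0

theorem cast_choose_two (k : ℕ) : ((k.choose 2 : ℕ) : ℤ) = ((k : ℤ) * (k - 1)) / 2 := by
  rw [Nat.choose_two_right]
  rcases k with _ | k
  · simp
  · push_cast [Nat.add_sub_cancel]; simp

/-- The finite form of the Jacobi triple product identity. -/
theorem finite_triple_product {q z : ℂ} (hq : q ≠ 0) (hz : z ≠ 0) (N : ℕ) :
    (∏ i ∈ Finset.range N, (1 - z * q ^ i)) * ∏ i ∈ Finset.range N, (1 - z⁻¹ * q ^ (i + 1)) =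
      ∑ k ∈ Finset.range (2 * N + 1), gaussBinom q (2 * N) k *
        ((-z) ^ ((k : ℤ) - N) * q ^ ((((k : ℤ) - N) * ((k : ℤ) - N - 1)) / 2)) := by
  -- The shift by `q^(-N)` centres the `2N` factors: the last `N` form the product in `z`, and the
  -- first `N`, reversed and rescaled, the product in `z⁻¹`.
  have h := prod_one_add_mul_pow q (-z * q ^ (-(N : ℤ))) (2 * N)
  rw [two_mul, Finset.prod_range_add, ← two_mul] at h
  have h2 : ∏ i ∈ Finset.range N, (1 + -z * q ^ (-(N : ℤ)) * q ^ (N + i)) =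
      ∏ i ∈ Finset.range N, (1 - z * q ^ i) := by
    refine Finset.prod_congr rfl fun i _ => ?_
    rw [pow_add, zpow_neg, zpow_natCast]
    field_simp
    ring
  have h1 : ∀ M : ℕ, ∏ i ∈ Finset.range M, (1 + -z * q ^ (-(M : ℤ)) * q ^ i) =
      (-z) ^ M * q ^ (-((M + 1).choose 2 : ℤ)) *
        ∏ i ∈ Finset.range M, (1 - z⁻¹ * q ^ (i + 1)) := by
    intro M
    rw [← Finset.prod_range_reflect]
    have : ∀ i ∈ Finset.range M, 1 + -z * q ^ (-(M : ℤ)) * q ^ (M - 1 - i) =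
        (-z) * (q ^ (i + 1))⁻¹ * (1 - z⁻¹ * q ^ (i + 1)) := by
      intro i hi
      have hi := Finset.mem_range.1 hi
      have : q ^ M = q ^ (M - 1 - i) * q ^ (i + 1) := by rw [← pow_add]; congr 1; omega
      rw [zpow_neg, zpow_natCast, this]
      field_simp
      ring
    rw [Finset.prod_congr rfl this, Finset.prod_mul_distrib, Finset.prod_mul_distrib,
      Finset.prod_const, Finset.card_range, Finset.prod_inv_distrib, Finset.prod_pow_eq_pow_sum,
      zpow_neg, zpow_natCast]
    congr 4
    have := Finset.sum_range_succ' (fun i => i) M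
    rw [Finset.sum_range_id, ← Nat.choose_two_right] at this
    rw [this, add_zero]
  rw [h1, h2] at h
  have hz' : (-z) ≠ 0 := neg_ne_zero.2 hz
  have hne : (-z) ^ N * q ^ (-((N + 1).choose 2 : ℤ)) ≠ 0 :=
    mul_ne_zero (pow_ne_zero _ hz') (zpow_ne_zero _ hq)
  apply mul_left_cancel₀ hne
  rw [Finset.mul_sum]
  refine (Eq.trans (by ring) h).trans (Finset.sum_congr rfl fun k _ => ?_)
  have e1 : (-z) ^ k = (-z) ^ N * (-z) ^ ((k : ℤ) - N) := by
    rw [← zpow_natCast, ← zpow_natCast, ← zpow_add₀ hz']; congr 1; ring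
  have e2 : q ^ k.choose 2 * (q ^ (-(N : ℤ))) ^ k = q ^ (-((N + 1).choose 2 : ℤ)) *
      q ^ ((((k : ℤ) - N) * ((k : ℤ) - N - 1)) / 2) := by
    rw [← zpow_natCast, ← zpow_natCast, ← zpow_mul, ← zpow_add₀ hq, ← zpow_add₀ hq,
      cast_choose_two, cast_choose_two]
    congr 1
    push_cast
    have a1 : 2 ∣ (k : ℤ) * (k - 1) := (Int.even_mul_pred_self _).two_dvd
    have a2 : 2 ∣ ((N : ℤ) + 1) * (N + 1 - 1) := (Int.even_mul_pred_self _).two_dvd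
    have a3 : 2 ∣ ((k : ℤ) - N) * (k - N - 1) := (Int.even_mul_pred_self _).two_dvd
    obtain ⟨u, hu⟩ := a1
    obtain ⟨v, hv⟩ := a2
    obtain ⟨w, hw⟩ := a3
    rw [hu, hv, hw]
    simp only [ne_eq, OfNat.ofNat_ne_zero, not_false_eq_true, Int.mul_ediv_cancel_left]
    linarith
  rw [mul_pow, e1]
  linear_combination gaussBinom q (2 * N) k * (-z) ^ N * (-z) ^ ((k : ℤ) - N) * e2

/-! ### Summability of theta series and the Jacobi triple product. -/

theorem summable_pow_natAbs {r : ℝ} (h0 : 0 ≤ r) (h1 : r < 1) :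
    Summable fun n : ℤ => r ^ n.natAbs := by
  refine Summable.of_nat_of_neg ?_ ?_ <;> simpa using summable_geometric_of_lt_one h0 h1

/-- A common majorant for all the theta series. The slack of one, paid for by `r⁻¹`, is needed
because the triangular exponent `n(n-1)/2` vanishes at `n = 1`. -/
theorem norm_zpow_le_of_natAbs_le {q : ℂ} {r : ℝ} (h0 : 0 < r) (h1 : r < 1) (hq : ‖q‖ ≤ r)
    {n e : ℤ} (he0 : 0 ≤ e) (he : (n.natAbs : ℤ) ≤ e + 1) :
    ‖q ^ e‖ ≤ r⁻¹ * r ^ n.natAbs := by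
  lift e to ℕ using he0
  rw [zpow_natCast, norm_pow]
  refine (pow_le_pow_left₀ (norm_nonneg q) hq e).trans ?_
  rw [← div_eq_inv_mul, le_div_iff₀ h0, ← pow_succ]
  exact pow_le_pow_of_le_one h0.le h1.le (by omega)

theorem triangular_nonneg (n : ℤ) : 0 ≤ n * (n - 1) / 2 := by
  refine Int.ediv_nonneg ?_ (by norm_num)
  rcases le_or_gt n 0 with h | h <;> nlinarith

theorem natAbs_le_triangular (n : ℤ) : (n.natAbs : ℤ) ≤ n * (n - 1) / 2 + 1 := by
  have : (n.natAbs : ℤ) - 1 ≤ n * (n - 1) / 2 := by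
    rw [Int.le_ediv_iff_mul_le (by norm_num), Int.natCast_natAbs]
    rcases abs_cases n with ⟨h, h'⟩ | ⟨h, h'⟩ <;> rw [h]
    · rcases le_or_gt n 1 with h2 | h2
      · nlinarith
      · nlinarith
    · nlinarith
  omega

theorem exists_radius {q : ℂ} (hq : ‖q‖ < 1) : ∃ r : ℝ, 0 < r ∧ r < 1 ∧ ‖q‖ < r := by
  obtain ⟨r, h1, h2⟩ := exists_between hq
  exact ⟨r, (norm_nonneg q).trans_lt h1, h2, h1⟩

theorem norm_neg_zpow {z : ℂ} (hz : ‖z‖ = 1) (n : ℤ) : ‖(-z) ^ n‖ = 1 := by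
  rw [norm_zpow, norm_neg, hz, one_zpow]

theorem summable_theta {q z : ℂ} (hq : ‖q‖ < 1) (hz : ‖z‖ = 1) :
    Summable fun n : ℤ => (-z) ^ n * q ^ (n * (n - 1) / 2) := by
  obtain ⟨r, h0, h1, hr⟩ := exists_radius hq
  refine Summable.of_norm_bounded ((summable_pow_natAbs h0.le h1).mul_left r⁻¹) fun n => ?_
  rw [norm_mul, norm_neg_zpow hz, one_mul]
  exact norm_zpow_le_of_natAbs_le h0 h1 hr.le (triangular_nonneg n) (natAbs_le_triangular n)

/-- The central Gaussian binomial coefficients, indexed by the distance from the middle. -/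
noncomputable def centralGauss (q : ℂ) (N : ℕ) (n : ℤ) : ℂ :=
  if n.natAbs ≤ N then gaussBinom q (2 * N) (n + N).toNat else 0

theorem centralGauss_eq {q : ℂ} (hq : ‖q‖ < 1) {N : ℕ} {n : ℤ} (h : n.natAbs ≤ N) :
    centralGauss q N n =
      qFactor q (2 * N) * (qFactor q (N - n).toNat)⁻¹ * (qFactor q (n + N).toNat)⁻¹ := by
  have := gaussBinom_mul_qFactor q (N - n).toNat (n + N).toNat
  rw [(by omega : (N - n).toNat + (n + N).toNat = 2 * N)] at this
  rw [centralGauss, if_pos h, ← this]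
  have := qFactor_ne_zero hq (N - n).toNat
  have := qFactor_ne_zero hq (n + N).toNat
  field_simp

theorem tendsto_centralGauss {q : ℂ} (hq : ‖q‖ < 1) (n : ℤ) :
    Tendsto (fun N => centralGauss q N n) atTop (𝓝 (eulerProd q)⁻¹) := by
  have hE := eulerProd_ne_zero hq
  have t := tendsto_qFactor hq
  have t1 : Tendsto (fun N : ℕ => 2 * N) atTop atTop :=
    tendsto_atTop.2 fun b => (eventually_ge_atTop b).mono fun N hN => by omega
  have t2 : Tendsto (fun N : ℕ => ((N : ℤ) - n).toNat) atTop atTop :=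
    tendsto_atTop.2 fun b => (eventually_ge_atTop (b + n.natAbs)).mono fun N hN => by omega
  have t3 : Tendsto (fun N : ℕ => (n + (N : ℤ)).toNat) atTop atTop :=
    tendsto_atTop.2 fun b => (eventually_ge_atTop (b + n.natAbs)).mono fun N hN => by omega
  have := ((t.comp t1).mul ((t.comp t2).inv₀ hE)).mul ((t.comp t3).inv₀ hE)
  rw [mul_inv_cancel₀ hE, one_mul] at this
  exact this.congr' ((eventually_ge_atTop n.natAbs).mono fun N hN => (centralGauss_eq hq hN).symm)

/-- The finite Euler products and their inverses converge, hence are bounded. Uniformity in `N` and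
`n` is what dominated convergence requires. -/
theorem exists_bound_centralGauss {q : ℂ} (hq : ‖q‖ < 1) :
    ∃ K : ℝ, ∀ N n, ‖centralGauss q N n‖ ≤ K := by
  have t := tendsto_qFactor hq
  obtain ⟨K₁, h₁⟩ := (Metric.isBounded_range_of_tendsto _ t).exists_norm_le
  obtain ⟨K₂, h₂⟩ :=
    (Metric.isBounded_range_of_tendsto _ (t.inv₀ (eulerProd_ne_zero hq))).exists_norm_le
  have h₁' : ∀ n, ‖qFactor q n‖ ≤ K₁ := fun n => h₁ _ ⟨n, rfl⟩
  have h₂' : ∀ n, ‖(qFactor q n)⁻¹‖ ≤ K₂ := fun n => h₂ _ ⟨n, rfl⟩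
  have p₁ : 0 ≤ K₁ := (norm_nonneg _).trans (h₁' 0)
  have p₂ : 0 ≤ K₂ := (norm_nonneg _).trans (h₂' 0)
  refine ⟨K₁ * K₂ * K₂, fun N n => ?_⟩
  by_cases h : n.natAbs ≤ N
  · rw [centralGauss_eq hq h, norm_mul, norm_mul]
    gcongr
    exacts [h₁' _, h₂' _, h₂' _]
  · rw [centralGauss, if_neg h, norm_zero]
    positivity

theorem finite_triple_product_eq_tsum {q z : ℂ} (hq : q ≠ 0) (hz : z ≠ 0) (N : ℕ) :
    (∏ i ∈ Finset.range N, (1 - z * q ^ i)) * ∏ i ∈ Finset.range N, (1 - z⁻¹ * q ^ (i + 1)) =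
      ∑' n : ℤ, centralGauss q N n * ((-z) ^ n * q ^ (n * (n - 1) / 2)) := by
  rw [finite_triple_product hq hz, tsum_eq_sum (s := Finset.Icc (-(N : ℤ)) N)]
  · refine Finset.sum_nbij' (fun k => (k : ℤ) - N) (fun n => (n + N).toNat) ?_ ?_ ?_ ?_ ?_
    · intro k hk; simp only [Finset.mem_range, Finset.mem_Icc] at *; omega
    · intro k hk; simp only [Finset.mem_range, Finset.mem_Icc] at *; omega
    · intro k hk; simp
    · intro k hk; simp only [Finset.mem_Icc] at *; omega
    · intro k hk
      have : ((k : ℤ) - N).natAbs ≤ N := by simp only [Finset.mem_range] at hk; omega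
      rw [centralGauss, if_pos this]
      simp
  · intro n hn
    have : ¬ n.natAbs ≤ N := by simp only [Finset.mem_Icc] at hn; omega
    rw [centralGauss, if_neg this, zero_mul]

/-- The Jacobi triple product identity for `z` on the unit circle. -/
theorem jacobi_triple_product {q z : ℂ} (hq0 : q ≠ 0) (hq : ‖q‖ < 1) (hz : ‖z‖ = 1) :
    ∑' n : ℤ, (-z) ^ n * q ^ (n * (n - 1) / 2) =
      (1 - z) * (eulerProd q * twistedProd z q * twistedProd z⁻¹ q) := by
  have hz0 : z ≠ 0 := norm_ne_zero_iff.1 (by rw [hz]; exact one_ne_zero)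
  obtain ⟨K, hK⟩ := exists_bound_centralGauss hq
  have lim : Tendsto (fun N => ∑' n : ℤ, centralGauss q N n * ((-z) ^ n * q ^ (n * (n - 1) / 2)))
      atTop (𝓝 (∑' n : ℤ, (eulerProd q)⁻¹ * ((-z) ^ n * q ^ (n * (n - 1) / 2)))) := by
    refine tendsto_tsum_of_dominated_convergence
      ((summable_theta hq hz).norm.mul_left K) (fun n => ?_) (Eventually.of_forall fun N n => ?_)
    · exact (tendsto_centralGauss hq n).mul_const _
    · rw [norm_mul]
      exact mul_le_mul_of_nonneg_right (hK N n) (norm_nonneg _)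
  have t1 : Tendsto (fun N => ∏ i ∈ Finset.range N, (1 - z * q ^ i)) atTop
      (𝓝 ((1 - z) * twistedProd z q)) := by
    -- This product starts at `q^0`; passing to `N + 1` factors splits off `1 - z`.
    rw [← tendsto_add_atTop_iff_nat 1]
    simp only [Finset.prod_range_succ', pow_zero, mul_one]
    rw [mul_comm]
    exact (tendsto_prod_twisted z hq).mul_const _
  have := tendsto_nhds_unique lim (((t1.mul (tendsto_prod_twisted z⁻¹ hq))).congr
    fun N => finite_triple_product_eq_tsum hq0 hz0 N)
  rw [tsum_mul_left, inv_mul_eq_iff_eq_mul₀ (eulerProd_ne_zero hq)] at this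
  rw [this]
  ring


/-! ### The 5-dissection of the theta series. -/

/-- The theta series `∑ (-1)^n q^{(5n² - 3n)/2}`. -/
noncomputable def sumA (q : ℂ) : ℂ := ∑' n : ℤ, (-1 : ℂ) ^ n * q ^ ((5 * n ^ 2 - 3 * n) / 2)

/-- The theta series `∑ (-1)^n q^{(5n² - n)/2}`. -/
noncomputable def sumB (q : ℂ) : ℂ := ∑' n : ℤ, (-1 : ℂ) ^ n * q ^ ((5 * n ^ 2 - n) / 2)

theorem half_eq {A B c : ℤ} (hB : Even B) (h : A = 5 * B + 2 * c) : A / 2 = 5 * (B / 2) + c := by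
  obtain ⟨w, rfl⟩ := hB
  omega

theorem even_five_sq_sub (m : ℤ) : Even (5 * m ^ 2 - m) := by
  rcases Int.even_or_odd' m with ⟨k, rfl | rfl⟩
  · exact ⟨10 * k ^ 2 - k, by ring⟩
  · exact ⟨10 * k ^ 2 + 9 * k + 2, by ring⟩

theorem even_five_sq_sub_three (m : ℤ) : Even (5 * m ^ 2 - 3 * m) := by
  rcases Int.even_or_odd' m with ⟨k, rfl | rfl⟩
  · exact ⟨10 * k ^ 2 - 3 * k, by ring⟩
  · exact ⟨10 * k ^ 2 + 7 * k + 1, by ring⟩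

theorem pow_five_zpow (x : ℂ) (e : ℤ) : (x ^ 5) ^ e = x ^ (5 * e) := by
  rw [← zpow_natCast, ← zpow_mul]; rfl

theorem neg_zpow_five_mul_add {ζ : ℂ} (hζ : ζ ^ 5 = 1) (m : ℤ) (j : ℕ) :
    (-ζ) ^ (m * 5 + (j : ℤ)) = (-1) ^ m * (-ζ) ^ j := by
  have h0 : -ζ ≠ 0 := neg_ne_zero.2 fun h => by simp [h] at hζ
  have h5 : (-ζ) ^ (5 : ℤ) = -1 := by
    rw [← Nat.cast_ofNat, zpow_natCast, Odd.neg_pow (by decide), hζ]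
  rw [zpow_add₀ h0, mul_comm m 5, zpow_mul, h5, zpow_natCast]

/-- The `5`-dissection of the theta series at a fifth root of unity. -/
theorem theta_dissection {x ζ : ℂ} (hx0 : x ≠ 0) (hx : ‖x‖ < 1) (hζ : ζ ^ 5 = 1) :
    ∑' n : ℤ, (-ζ) ^ n * x ^ (n * (n - 1) / 2) =
      (1 - ζ) * sumB (x ^ 5) + (ζ ^ 2 - ζ ^ 4) * (x * sumA (x ^ 5)) := by
  have hn : ‖ζ‖ = 1 := Complex.norm_eq_one_of_pow_eq_one hζ (by norm_num)
  have hs := summable_theta hx hn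
  -- The symmetry `n ↦ 1 - n` of the exponent swaps the classes 0 and 1 and the classes 2 and 4, and
  -- fixes class 3: the first pair gives `sumB`, the second `sumA`.
  let e : Fin 5 × ℤ ≃ ℤ := (Equiv.prodComm (Fin 5) ℤ).trans (Int.divModEquiv 5).symm
  have he : ∀ (j : Fin 5) (m : ℤ), e (j, m) = m * 5 + ((j : ℕ) : ℤ) := fun j m => rfl
  have hp := (e.summable_iff.2 hs).tsum_prod.trans (tsum_fintype _)
  rw [Fin.sum_univ_five] at hp
  simp only [Function.comp_apply] at hp
  rw [← e.tsum_eq, hp]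
  simp only [he, neg_zpow_five_mul_add hζ]
  have hneg : ∀ m : ℤ, ((-1 : ℂ) ^ m)⁻¹ = (-1) ^ m := fun m => by rw [← inv_zpow, inv_neg_one]
  have h0 : ∑' m : ℤ, (-1 : ℂ) ^ m * (-ζ) ^ ((0 : Fin 5) : ℕ) *
      x ^ ((m * 5 + (((0 : Fin 5) : ℕ) : ℤ)) * (m * 5 + (((0 : Fin 5) : ℕ) : ℤ) - 1) / 2) =
      sumB (x ^ 5) := by
    refine tsum_congr fun m => ?_
    rw [half_eq (even_five_sq_sub m) (c := 0) (by norm_num; ring), pow_five_zpow]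
    simp
  have h1 : ∑' m : ℤ, (-1 : ℂ) ^ m * (-ζ) ^ ((1 : Fin 5) : ℕ) *
      x ^ ((m * 5 + (((1 : Fin 5) : ℕ) : ℤ)) * (m * 5 + (((1 : Fin 5) : ℕ) : ℤ) - 1) / 2) =
      -ζ * sumB (x ^ 5) := by
    rw [sumB, ← tsum_mul_left, ← (Equiv.neg ℤ).tsum_eq]
    refine tsum_congr fun m => ?_
    rw [half_eq (even_five_sq_sub m) (c := 0) (by norm_num; ring), pow_five_zpow]
    simp [hneg]
    ring
  have h2 : ∑' m : ℤ, (-1 : ℂ) ^ m * (-ζ) ^ ((2 : Fin 5) : ℕ) *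
      x ^ ((m * 5 + (((2 : Fin 5) : ℕ) : ℤ)) * (m * 5 + (((2 : Fin 5) : ℕ) : ℤ) - 1) / 2) =
      ζ ^ 2 * (x * sumA (x ^ 5)) := by
    rw [sumA, ← tsum_mul_left, ← tsum_mul_left, ← (Equiv.neg ℤ).tsum_eq]
    refine tsum_congr fun m => ?_
    rw [half_eq (even_five_sq_sub_three m) (c := 1) (by norm_num; ring), pow_five_zpow,
      zpow_add_one₀ hx0]
    simp [hneg]
    ring
  have h3 : ∑' m : ℤ, (-1 : ℂ) ^ m * (-ζ) ^ ((3 : Fin 5) : ℕ) *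
      x ^ ((m * 5 + (((3 : Fin 5) : ℕ) : ℤ)) * (m * 5 + (((3 : Fin 5) : ℕ) : ℤ) - 1) / 2) = 0 := by
    -- On the class `n = 5m + 3` the symmetry reads `m ↦ -1 - m`; it keeps the exponent and reverses
    -- the sign `(-1)^m`.
    refine self_eq_neg.1 ?_
    rw [← tsum_neg, ← (Equiv.subLeft (-1 : ℤ)).tsum_eq]
    refine tsum_congr fun m => ?_
    have : (-1 : ℂ) ^ (-1 - m) = -(-1) ^ m := by
      rw [zpow_sub₀ (by norm_num)]
      rcases Int.even_or_odd m with h | h <;> simp [h.neg_one_zpow]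
    rw [Equiv.subLeft_apply, this, neg_mul, neg_mul]
    congr 4
    norm_num
    ring
  have h4 : ∑' m : ℤ, (-1 : ℂ) ^ m * (-ζ) ^ ((4 : Fin 5) : ℕ) *
      x ^ ((m * 5 + (((4 : Fin 5) : ℕ) : ℤ)) * (m * 5 + (((4 : Fin 5) : ℕ) : ℤ) - 1) / 2) =
      -ζ ^ 4 * (x * sumA (x ^ 5)) := by
    rw [sumA, ← tsum_mul_left, ← tsum_mul_left, ← (Equiv.addRight (1 : ℤ)).tsum_eq
      (fun n : ℤ => -ζ ^ 4 * (x * ((-1) ^ n * (x ^ 5) ^ ((5 * n ^ 2 - 3 * n) / 2))))]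
    refine tsum_congr fun m => ?_
    rw [half_eq (even_five_sq_sub_three (m + 1)) (c := 1) (by norm_num; ring), pow_five_zpow,
      zpow_add_one₀ hx0, Equiv.coe_addRight, zpow_add_one₀ (by norm_num : (-1 : ℂ) ≠ 0)]
    simp
    ring
  rw [h0, h1, h2, h3, h4]
  ring

/-! ### Products over the fifth roots of unity. -/

theorem prod_range_add_mul {ζ : ℂ} {n : ℕ} (hn : Odd n) (hζ : IsPrimitiveRoot ζ n) (u v : ℂ) :
    ∏ j ∈ Finset.range n, (u + ζ ^ j * v) = u ^ n + v ^ n := by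
  rw [hζ.pow_add_pow_eq_prod_add_mul u v hn]
  have : NeZero n := ⟨hn.pos.ne'⟩
  refine Finset.prod_nbij (fun j => ζ ^ j) (fun j _ => ?_) ?_ (fun η hη => ?_) fun _ _ => rfl
  · rw [Polynomial.mem_nthRootsFinset hn.pos, ← pow_mul, mul_comm, pow_mul, hζ.pow_eq_one, one_pow]
  · exact hζ.injOn_pow.mono fun j hj => by simpa using hj
  · obtain ⟨i, hi, rfl⟩ := hζ.eq_pow_of_pow_eq_one ((Polynomial.mem_nthRootsFinset hn.pos 1).1 hη)
    exact ⟨i, by simpa using hi, rfl⟩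

/-- If `5 ∣ n`, all five factors coincide; otherwise `ζ^n` is again primitive and the factors
multiply to `1 - (c x^n)^5`, where `c^5 = 1` removes `c`. -/
theorem prod_one_sub_root_mul {ζ c : ℂ} (hζ : IsPrimitiveRoot ζ 5) (hc : c ^ 5 = 1) (x : ℂ)
    (n : ℕ) : ∏ j ∈ Finset.range 5, (1 - c * (ζ ^ j * x) ^ n) =
      if 5 ∣ n then (1 - c * x ^ n) ^ 5 else 1 - x ^ (5 * n) := by
  have h : ∀ j : ℕ, c * (ζ ^ j * x) ^ n = (ζ ^ n) ^ j * (c * x ^ n) := fun j => by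
    rw [mul_pow, ← pow_mul, ← pow_mul, mul_comm j n]; ring
  simp only [h]
  split_ifs with h5
  · rw [(hζ.pow_eq_one_iff_dvd n).2 h5]
    simp
  · have hη : IsPrimitiveRoot (ζ ^ n) 5 :=
      hζ.pow_of_coprime n ((Nat.Prime.coprime_iff_not_dvd Nat.prime_five).2 h5).symm
    have := prod_range_add_mul (by decide) hη 1 (-(c * x ^ n))
    simp only [mul_neg, ← sub_eq_add_neg] at this
    rw [this, Odd.neg_pow (by decide), mul_pow, hc, ← pow_mul, mul_comm n 5]
    ring

theorem hasProd_twisted (c : ℂ) {q : ℂ} (hq : ‖q‖ < 1) :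
    HasProd (fun n : ℕ => 1 - c * q ^ (n + 1)) (twistedProd c q) :=
  (multipliable_twisted c hq).hasProd

theorem norm_pow_five_lt_one {x : ℂ} (hx : ‖x‖ < 1) : ‖x ^ 5‖ < 1 := by
  rw [norm_pow]
  exact pow_lt_one₀ (norm_nonneg x) hx (by norm_num)

theorem hasProd_multiples_of_five {g : ℕ → ℂ} {w : ℂ} (h : HasProd (fun n => g (5 * (n + 1))) w) :
    HasProd (fun n => if 5 ∣ n + 1 then g (n + 1) else 1) w := by
  have hi : Function.Injective fun n : ℕ => 5 * n + 4 := fun a b h => by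
    simp only at h; omega
  refine (hi.hasProd_iff fun n hn => if_neg fun hd => hn ?_).1 (h.congr_fun ?_)
  · obtain ⟨k, hk⟩ := hd
    exact ⟨k - 1, by simp only; omega⟩
  · intro n
    have : 5 * n + 4 + 1 = 5 * (n + 1) := by ring
    simp [this]

/-- The product of `∏ (1 - c q^n)` over the five fifth roots `q` of a number. -/
theorem prod_twistedProd {ζ c x : ℂ} (hζ : IsPrimitiveRoot ζ 5) (hc : c ^ 5 = 1) (hx : ‖x‖ < 1) :
    eulerProd (x ^ 25) * ∏ j ∈ Finset.range 5, twistedProd c (ζ ^ j * x) =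
      eulerProd (x ^ 5) * twistedProd c (x ^ 5) ^ 5 := by
  have hn : ‖ζ‖ = 1 := Complex.norm_eq_one_of_pow_eq_one hζ.pow_eq_one (by norm_num)
  have h5 := norm_pow_five_lt_one hx
  have h25 : ‖x ^ 25‖ < 1 := by
    have := norm_pow_five_lt_one h5
    rwa [← pow_mul] at this
  have l1 : HasProd (fun n => if 5 ∣ n + 1 then 1 - x ^ (5 * (n + 1)) else 1)
      (eulerProd (x ^ 25)) := by
    refine hasProd_multiples_of_five (g := fun n => 1 - x ^ (5 * n)) ?_
    rw [← twistedProd_one]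
    refine (hasProd_twisted 1 h25).congr_fun fun n => ?_
    rw [one_mul, ← pow_mul]
    ring_nf
  have l2 : HasProd (fun n => ∏ j ∈ Finset.range 5, (1 - c * (ζ ^ j * x) ^ (n + 1)))
      (∏ j ∈ Finset.range 5, twistedProd c (ζ ^ j * x)) :=
    hasProd_prod fun j _ => hasProd_twisted c (by rwa [norm_mul, norm_pow, hn, one_pow, one_mul])
  have r1 : HasProd (fun n => 1 - x ^ (5 * (n + 1))) (eulerProd (x ^ 5)) := by
    rw [← twistedProd_one]
    exact (hasProd_twisted 1 h5).congr_fun fun n => by rw [one_mul, ← pow_mul]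
  have r2 : HasProd (fun n => if 5 ∣ n + 1 then (1 - c * x ^ (n + 1)) ^ 5 else 1)
      (twistedProd c (x ^ 5) ^ 5) := by
    refine hasProd_multiples_of_five (g := fun n => (1 - c * x ^ n) ^ 5) ?_
    have := hasProd_prod (s := Finset.range 5) fun _ _ => hasProd_twisted c h5
    simpa [← pow_mul] using this
  -- Both sides agree factor by factor: the Euler product at `x^25` supplies exactly the factors `1
  -- - x^(5n)` with `5 ∣ n` that the root product misses.
  refine (l1.mul l2).unique ((r1.mul r2).congr_fun fun n => ?_)
  rw [prod_one_sub_root_mul hζ hc]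
  split_ifs <;> ring

theorem sumB_add_mul_sumA {x ζ : ℂ} (hx0 : x ≠ 0) (hx : ‖x‖ < 1) (hζ : IsPrimitiveRoot ζ 5) :
    sumB (x ^ 5) + (ζ ^ 2 + ζ ^ 3) * (x * sumA (x ^ 5)) =
      twistedProd 1 x * twistedProd ζ x * twistedProd ζ⁻¹ x := by
  have hn : ‖ζ‖ = 1 := Complex.norm_eq_one_of_pow_eq_one hζ.pow_eq_one (by norm_num)
  have h1 : 1 - ζ ≠ 0 := sub_ne_zero.2 (hζ.ne_one (by norm_num)).symm
  -- The dissection is divisible by `1 - ζ`, since `ζ^2 - ζ^4 = (1 - ζ)(ζ^2 + ζ^3)`.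
  apply mul_left_cancel₀ h1
  rw [twistedProd_one, ← jacobi_triple_product hx0 hx hn, theta_dissection hx0 hx hζ.pow_eq_one]
  ring

/-! ### The quintic identities for `A` and `B`. -/

theorem eulerPow_pow (s q : ℂ) (n : ℕ) : eulerPow s q ^ n = eulerPow (n * s) q := by
  rw [eulerPow, eulerPow, ← Complex.exp_nat_mul, mul_assoc]

theorem eulerPow_neg_three_mul {q : ℂ} (hq : ‖q‖ < 1) : eulerPow (-3) q * eulerProd q ^ 3 = 1 := by
  rw [← eulerPow_one hq, eulerPow_pow, eulerPow, eulerPow, ← Complex.exp_add]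
  norm_num

theorem thetaA_eq (x : ℂ) : thetaA x = x * eulerPow (-(3 / 5)) (x ^ 5) * sumA (x ^ 5) := rfl

theorem thetaB_eq (x : ℂ) : thetaB x = eulerPow (-(3 / 5)) (x ^ 5) * sumB (x ^ 5) := rfl

theorem eulerPow_pow_five (q : ℂ) : eulerPow (-(3 / 5)) q ^ 5 = eulerPow (-3) q := by
  rw [eulerPow_pow]
  norm_num

theorem thetaA_pow_five (x : ℂ) :
    thetaA x ^ 5 = x ^ 5 * eulerPow (-3) (x ^ 5) * sumA (x ^ 5) ^ 5 := by
  rw [thetaA_eq, mul_pow, mul_pow, eulerPow_pow_five]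

theorem thetaB_pow_five (x : ℂ) : thetaB x ^ 5 = eulerPow (-3) (x ^ 5) * sumB (x ^ 5) ^ 5 := by
  rw [thetaB_eq, mul_pow, eulerPow_pow_five]

theorem thetaA_mul_of_pow_five {ζ : ℂ} (hζ : ζ ^ 5 = 1) (x : ℂ) :
    thetaA (ζ * x) = ζ * thetaA x := by
  rw [thetaA_eq, thetaA_eq, mul_pow, hζ, one_mul]
  ring

theorem thetaB_mul_of_pow_five {ζ : ℂ} (hζ : ζ ^ 5 = 1) (x : ℂ) : thetaB (ζ * x) = thetaB x := by
  rw [thetaB_eq, thetaB_eq, mul_pow, hζ, one_mul]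

theorem thetaA_zero : thetaA 0 = 0 := by simp [thetaA]

/-- The triple-product factorization is multiplied over `ζ^j y` and compared with its own fifth
power at `y^5`. The leftover Euler factors `eulerProd^3` at `y^5` and `y^25` are exactly those
absorbed by the normalization exponent `-3/5`. -/
theorem thetaB_add_mul_thetaA_pow_five {y ζ : ℂ} (hy : ‖y‖ < 1) (hζ : IsPrimitiveRoot ζ 5) :
    (thetaB (y ^ 5) + (ζ ^ 2 + ζ ^ 3) * thetaA (y ^ 5)) ^ 5 =
      thetaB y ^ 5 + (ζ ^ 2 + ζ ^ 3) ^ 5 * thetaA y ^ 5 := by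
  rcases eq_or_ne y 0 with rfl | hy0
  · simp [thetaA_zero]
  have hn : ‖ζ‖ = 1 := Complex.norm_eq_one_of_pow_eq_one hζ.pow_eq_one (by norm_num)
  have h5 := norm_pow_five_lt_one hy
  have h25 := norm_pow_five_lt_one h5
  set φ := ζ ^ 2 + ζ ^ 3
  have hC := sumB_add_mul_sumA (pow_ne_zero 5 hy0) h5 hζ
  have hprod : ∏ j ∈ Finset.range 5, (twistedProd 1 (ζ ^ j * y) * twistedProd ζ (ζ ^ j * y) *
      twistedProd ζ⁻¹ (ζ ^ j * y)) = sumB (y ^ 5) ^ 5 + (φ * (y * sumA (y ^ 5))) ^ 5 := by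
    rw [← prod_range_add_mul (by decide) hζ]
    refine Finset.prod_congr rfl fun j _ => ?_
    have hr : (ζ ^ j * y) ^ 5 = y ^ 5 := by
      rw [mul_pow, ← pow_mul, mul_comm j, pow_mul, hζ.pow_eq_one, one_pow, one_mul]
    rw [← sumB_add_mul_sumA (mul_ne_zero (pow_ne_zero _ (hζ.ne_zero (by norm_num))) hy0)
      (by rwa [norm_mul, norm_pow, hn, one_pow, one_mul]) hζ, hr]
    ring
  rw [Finset.prod_mul_distrib, Finset.prod_mul_distrib] at hprod
  have p1 := prod_twistedProd hζ (one_pow 5) hy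
  have p2 := prod_twistedProd hζ hζ.pow_eq_one hy
  have p3 := prod_twistedProd hζ hζ.inv.pow_eq_one hy
  have e1 := eulerPow_neg_three_mul h5
  have e2 := eulerPow_neg_three_mul h25
  rw [← pow_mul] at e2
  norm_num at e2
  have main : eulerProd (y ^ 25) ^ 3 * (sumB (y ^ 5) ^ 5 + (φ * (y * sumA (y ^ 5))) ^ 5) =
      eulerProd (y ^ 5) ^ 3 * (sumB ((y ^ 5) ^ 5) + φ * (y ^ 5 * sumA ((y ^ 5) ^ 5))) ^ 5 := by
    rw [hC, ← hprod]
    calc _ = (eulerProd (y ^ 25) * ∏ j ∈ Finset.range 5, twistedProd 1 (ζ ^ j * y)) *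
          (eulerProd (y ^ 25) * ∏ j ∈ Finset.range 5, twistedProd ζ (ζ ^ j * y)) *
          (eulerProd (y ^ 25) * ∏ j ∈ Finset.range 5, twistedProd ζ⁻¹ (ζ ^ j * y)) := by ring
      _ = _ := by rw [p1, p2, p3]; ring
  have hl : (thetaB (y ^ 5) + φ * thetaA (y ^ 5)) ^ 5 = eulerPow (-3) (y ^ 25) *
      (sumB ((y ^ 5) ^ 5) + φ * (y ^ 5 * sumA ((y ^ 5) ^ 5))) ^ 5 := by
    have : y ^ 25 = (y ^ 5) ^ 5 := by ring
    rw [this, ← eulerPow_pow_five, thetaA_eq, thetaB_eq]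
    ring
  rw [hl, thetaA_pow_five, thetaB_pow_five]
  generalize (sumB ((y ^ 5) ^ 5) + φ * (y ^ 5 * sumA ((y ^ 5) ^ 5))) ^ 5 = C at *
  linear_combination (-eulerPow (-3) (y ^ 25) * C) * e1
    - eulerPow (-3) (y ^ 25) * eulerPow (-3) (y ^ 5) * main
    + eulerPow (-3) (y ^ 5) * (sumB (y ^ 5) ^ 5 + (φ * (y * sumA (y ^ 5))) ^ 5) * e2

/-- `ζ^2 + ζ^3` and its conjugate `ζ + ζ^4` are the roots of `t^2 + t - 1`, so powers of `φ` reduce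
to linear expressions. -/
theorem root_sum_sq {ζ : ℂ} (hζ : IsPrimitiveRoot ζ 5) :
    (ζ ^ 2 + ζ ^ 3) ^ 2 = 1 - (ζ ^ 2 + ζ ^ 3) := by
  have h := hζ.geom_sum_eq_zero (by norm_num)
  simp only [Finset.sum_range_succ, Finset.sum_range_zero] at h
  linear_combination (2 + ζ) * hζ.pow_eq_one + h

theorem pow_of_sq_eq_one_sub {φ : ℂ} (h : φ ^ 2 = 1 - φ) :
    φ ^ 3 = 2 * φ - 1 ∧ φ ^ 4 = 2 - 3 * φ ∧ φ ^ 5 = 5 * φ - 3 := by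
  have h3 : φ ^ 3 = 2 * φ - 1 := by linear_combination (φ - 1) * h
  have h4 : φ ^ 4 = 2 - 3 * φ := by linear_combination φ * h3 + 2 * h
  exact ⟨h3, h4, by linear_combination φ * h4 - 3 * h⟩

theorem solve_quintic_pair {φ ψ A B A' B' : ℂ} (hφ : φ ^ 2 = 1 - φ) (hψ : ψ ^ 2 = 1 - ψ)
    (hne : φ ≠ ψ) (h : (B + φ * A) ^ 5 = B' + φ ^ 5 * A')
    (h' : (B + ψ * A) ^ 5 = B' + ψ ^ 5 * A') :
    A' = A ^ 5 - 3 * A ^ 4 * B + 4 * A ^ 3 * B ^ 2 - 2 * A ^ 2 * B ^ 3 + A * B ^ 4 ∧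
      B' = B ^ 5 + 3 * A * B ^ 4 + 4 * A ^ 2 * B ^ 3 + 2 * A ^ 3 * B ^ 2 + A ^ 4 * B := by
  obtain ⟨a3, a4, a5⟩ := pow_of_sq_eq_one_sub hφ
  obtain ⟨b3, b4, b5⟩ := pow_of_sq_eq_one_sub hψ
  have hA : A' = A ^ 5 - 3 * A ^ 4 * B + 4 * A ^ 3 * B ^ 2 - 2 * A ^ 2 * B ^ 3 + A * B ^ 4 := by
    -- Subtracting the equations eliminates `B'`; the coefficient of `A'` is `φ^5 - ψ^5 = 5(φ - ψ)`.
    apply mul_left_cancel₀ (mul_ne_zero (by norm_num : (5 : ℂ) ≠ 0) (sub_ne_zero.2 hne))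
    linear_combination h' - h + (10 * B ^ 3 * A ^ 2) * (hφ - hψ) + (10 * B ^ 2 * A ^ 3) * (a3 - b3)
      + (5 * B * A ^ 4) * (a4 - b4) + A ^ 5 * (a5 - b5) - A' * (a5 - b5)
  refine ⟨hA, ?_⟩
  linear_combination -h + (10 * B ^ 3 * A ^ 2) * hφ + (10 * B ^ 2 * A ^ 3) * a3
      + (5 * B * A ^ 4) * a4 + A ^ 5 * a5 - A' * a5 - (5 * φ - 3) * hA

/-- The pentamidiation formulas for `A^5` and `B^5`. -/
theorem pow_five_eq {y : ℂ} (hy : ‖y‖ < 1) :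
    thetaA y ^ 5 = thetaA (y ^ 5) ^ 5 - 3 * thetaA (y ^ 5) ^ 4 * thetaB (y ^ 5)
        + 4 * thetaA (y ^ 5) ^ 3 * thetaB (y ^ 5) ^ 2 - 2 * thetaA (y ^ 5) ^ 2 * thetaB (y ^ 5) ^ 3
        + thetaA (y ^ 5) * thetaB (y ^ 5) ^ 4 ∧
      thetaB y ^ 5 = thetaB (y ^ 5) ^ 5 + 3 * thetaA (y ^ 5) * thetaB (y ^ 5) ^ 4
        + 4 * thetaA (y ^ 5) ^ 2 * thetaB (y ^ 5) ^ 3 + 2 * thetaA (y ^ 5) ^ 3 * thetaB (y ^ 5) ^ 2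
        + thetaA (y ^ 5) ^ 4 * thetaB (y ^ 5) := by
  have hζ : IsPrimitiveRoot (Complex.exp (2 * Real.pi * Complex.I / (5 : ℕ))) 5 :=
    Complex.isPrimitiveRoot_exp 5 (by norm_num)
  set ζ := Complex.exp (2 * Real.pi * Complex.I / (5 : ℕ))
  have hζ' : IsPrimitiveRoot (ζ ^ 2) 5 := hζ.pow_of_coprime 2 (by norm_num)
  have hφ := root_sum_sq hζ
  have hψ := root_sum_sq hζ'
  refine solve_quintic_pair hφ hψ (fun h => ?_) (thetaB_add_mul_thetaA_pow_five hy hζ)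
    (thetaB_add_mul_thetaA_pow_five hy hζ')
  have hs := hζ.geom_sum_eq_zero (by norm_num)
  simp only [Finset.sum_range_succ, Finset.sum_range_zero] at hs
  -- The two roots sum to `-1`; if they were equal, the discriminant 5 of `t^2 + t - 1` would
  -- vanish.
  have h1 : 2 * (ζ ^ 2 + ζ ^ 3) = -1 := by linear_combination h + hs + ζ * hζ.pow_eq_one
  have : (5 : ℂ) = 0 := by
    linear_combination (2 * (ζ ^ 2 + ζ ^ 3) + 1) * h1 - 4 * hφ
  norm_num at this


/-! ### Analyticity in the unit disc and the power series of `F`. -/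

theorem differentiableOn_unit_ball {F : ℂ → ℂ}
    (h : ∀ r : ℝ, 0 < r → r < 1 → DifferentiableOn ℂ F (Metric.ball 0 r)) :
    DifferentiableOn ℂ F (Metric.ball 0 1) := by
  intro q hq
  obtain ⟨r, h0, h1, hr⟩ := exists_radius (mem_ball_zero_iff.1 hq)
  exact ((h r h0 h1).differentiableAt
    (Metric.isOpen_ball.mem_nhds (mem_ball_zero_iff.2 hr))).differentiableWithinAt

theorem differentiableOn_theta {e : ℤ → ℤ} (he0 : ∀ n, 0 ≤ e n)
    (he : ∀ n, (n.natAbs : ℤ) ≤ e n + 1) :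
    DifferentiableOn ℂ (fun q : ℂ => ∑' n : ℤ, (-1 : ℂ) ^ n * q ^ e n) (Metric.ball 0 1) := by
  refine differentiableOn_unit_ball fun r h0 h1 => ?_
  refine Complex.differentiableOn_tsum_of_summable_norm ((summable_pow_natAbs h0.le h1).mul_left r⁻¹)
    (fun n => ?_) Metric.isOpen_ball fun n q hq => ?_
  · exact (differentiableOn_zpow _ _ (Or.inr (he0 n))).const_mul _
  · rw [norm_mul, norm_neg_zpow norm_one, one_mul]
    exact norm_zpow_le_of_natAbs_le h0 h1 (mem_ball_zero_iff.1 hq).le (he0 n) (he n)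

theorem natAbs_le_half {n A : ℤ} (h : 2 * |n| ≤ A) : (n.natAbs : ℤ) ≤ A / 2 := by
  rw [Int.natCast_natAbs]
  omega

theorem two_mul_abs_le_of_sub_three (n : ℤ) : 2 * |n| ≤ 5 * n ^ 2 - 3 * n := by
  rcases abs_cases n with ⟨h, h'⟩ | ⟨h, h'⟩ <;> rw [h]
  · rcases h'.eq_or_lt with rfl | h2
    · norm_num
    · nlinarith
  · nlinarith

theorem two_mul_abs_le_of_sub (n : ℤ) : 2 * |n| ≤ 5 * n ^ 2 - n := by
  rcases abs_cases n with ⟨h, h'⟩ | ⟨h, h'⟩ <;> rw [h]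
  · rcases h'.eq_or_lt with rfl | h2
    · norm_num
    · nlinarith
  · nlinarith

theorem differentiableOn_sumA : DifferentiableOn ℂ sumA (Metric.ball 0 1) := by
  have h : ∀ n : ℤ, (n.natAbs : ℤ) ≤ (5 * n ^ 2 - 3 * n) / 2 := fun n =>
    natAbs_le_half (two_mul_abs_le_of_sub_three n)
  exact differentiableOn_theta (fun n => (Int.natCast_nonneg _).trans (h n))
    fun n => (h n).trans (Int.le_add_one le_rfl)

theorem differentiableOn_sumB : DifferentiableOn ℂ sumB (Metric.ball 0 1) := by
  have h : ∀ n : ℤ, (n.natAbs : ℤ) ≤ (5 * n ^ 2 - n) / 2 := fun n =>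
    natAbs_le_half (two_mul_abs_le_of_sub n)
  exact differentiableOn_theta (fun n => (Int.natCast_nonneg _).trans (h n))
    fun n => (h n).trans (Int.le_add_one le_rfl)

theorem norm_log_one_sub_le {z : ℂ} {r : ℝ} (hr : r < 1) (hz : ‖z‖ ≤ r) :
    ‖Complex.log (1 - z)‖ ≤ ((1 - r)⁻¹ / 2 + 1) * ‖z‖ := by
  have h1 : ‖z‖ < 1 := hz.trans_lt hr
  have h := Complex.norm_log_one_add_le (z := -z) (by rwa [norm_neg])
  rw [norm_neg, ← sub_eq_add_neg] at h
  refine h.trans ?_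
  have h2 : (1 - ‖z‖)⁻¹ ≤ (1 - r)⁻¹ := inv_anti₀ (by linarith) (by linarith)
  have h3 : 0 ≤ (1 - r)⁻¹ := inv_nonneg.2 (by linarith)
  have h4 : ‖z‖ ^ 2 ≤ ‖z‖ := by nlinarith [norm_nonneg z]
  have h5 : ‖z‖ ^ 2 * (1 - ‖z‖)⁻¹ ≤ ‖z‖ * (1 - r)⁻¹ :=
    mul_le_mul h4 h2 (inv_nonneg.2 (by linarith)) (norm_nonneg z)
  linarith

theorem differentiableOn_eulerPow (s : ℂ) :
    DifferentiableOn ℂ (eulerPow s) (Metric.ball 0 1) := by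
  refine differentiableOn_unit_ball fun r h0 h1 => ?_
  have hs : Summable fun n : ℕ => ((1 - r)⁻¹ / 2 + 1) * r ^ (n + 1) :=
    ((summable_nat_add_iff 1).2 (summable_geometric_of_lt_one h0.le h1)).mul_left _
  have hpow : ∀ (n : ℕ) (q : ℂ), q ∈ Metric.ball (0 : ℂ) r → ‖q ^ (n + 1)‖ ≤ r ^ (n + 1) :=
    fun n q hq => by
      rw [norm_pow]
      exact pow_le_pow_left₀ (norm_nonneg q) (mem_ball_zero_iff.1 hq).le _
  have hle : ∀ n : ℕ, r ^ (n + 1) ≤ r := fun n => pow_le_of_le_one h0.le h1.le n.succ_ne_zero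
  refine ((Complex.differentiableOn_tsum_of_summable_norm hs (fun n => ?_) Metric.isOpen_ball
    fun n q hq => ?_).const_mul s).cexp
  · refine DifferentiableOn.clog (by fun_prop) fun q hq => ?_
    have h : ‖-q ^ (n + 1)‖ < 1 := by
      rw [norm_neg]; exact ((hpow n q hq).trans (hle n)).trans_lt h1
    simpa [sub_eq_add_neg] using Complex.mem_slitPlane_of_norm_lt_one h
  · refine (norm_log_one_sub_le h1 ((hpow n q hq).trans (hle n))).trans ?_
    exact mul_le_mul_of_nonneg_left (hpow n q hq)
      (by have : 0 ≤ (1 - r)⁻¹ := inv_nonneg.2 (by linarith)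
          positivity)

/-- The function `∑ a_k A^{5k} B^{5(d-k)}` in terms of `q`. -/
noncomputable def formFun (d : ℕ) (a : Fin (d + 1) → ℂ) (q : ℂ) : ℂ :=
  ∑ k : Fin (d + 1), a k * (q * eulerPow (-3) q * sumA q ^ 5) ^ (k : ℕ) *
    (eulerPow (-3) q * sumB q ^ 5) ^ (d - (k : ℕ))

/-- Only fifth powers of `A` and `B` occur, so `x` enters through `x^5` alone and `F` is a function
of `q`. -/
theorem form_eq_formFun (d : ℕ) (a : Fin (d + 1) → ℂ) (x : ℂ) :
    form d a x = formFun d a (x ^ 5) := by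
  simp only [form, formFun, pow_mul, thetaA_pow_five, thetaB_pow_five]

theorem differentiableOn_formFun (d : ℕ) (a : Fin (d + 1) → ℂ) :
    DifferentiableOn ℂ (formFun d a) (Metric.ball 0 1) := by
  have h1 := differentiableOn_sumA
  have h2 := differentiableOn_sumB
  have h3 := differentiableOn_eulerPow (-3)
  unfold formFun
  fun_prop

theorem exists_powerSeries (d : ℕ) (a : Fin (d + 1) → ℂ) :
    ∃ f : ℂ⟦X⟧, ∀ q : ℂ, ‖q‖ < 1 → SumsTo f q (formFun d a q) := by
  refine ⟨PowerSeries.mk fun n => ((n.factorial : ℕ) : ℂ)⁻¹ * iteratedDeriv n (formFun d a) 0,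
    fun q hq => ?_⟩
  have := Complex.hasSum_taylorSeries_on_ball (differentiableOn_formFun d a)
    (mem_ball_zero_iff.2 hq)
  refine this.congr_fun fun n => ?_
  simp only [PowerSeries.coeff_mk, smul_eq_mul, sub_zero]
  ring

/-! ### The array as a table of multinomial coefficients. -/

theorem fWeight_add_gWeight {n : ℕ} {v : Fin 5 → ℕ} (hv : v ∈ compositions n) :
    fWeight v + gWeight v = 5 * n := by
  have h := (Finset.mem_piAntidiag.1 hv).1
  rw [Fin.sum_univ_five] at h
  rw [fWeight, gWeight]
  omega

theorem formB_pow (A B : ℂ) (n : ℕ) :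
    (B ^ 5 + 3 * A * B ^ 4 + 4 * A ^ 2 * B ^ 3 + 2 * A ^ 3 * B ^ 2 + A ^ 4 * B) ^ n =
      ∑ v ∈ compositions n, 2 ^ v 3 * 3 ^ v 1 * 4 ^ v 2 * (Nat.multinomial Finset.univ v : ℂ) *
        (A ^ gWeight v * B ^ fWeight v) := by
  have h := Finset.sum_pow_eq_sum_piAntidiag Finset.univ
    ![B ^ 5, 3 * A * B ^ 4, 4 * A ^ 2 * B ^ 3, 2 * A ^ 3 * B ^ 2, A ^ 4 * B] n
  simp only [Fin.sum_univ_five, Fin.prod_univ_five] at h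
  refine h.trans (Finset.sum_congr rfl fun v _ => ?_)
  simp only [fWeight, gWeight, Matrix.cons_val]
  simp only [mul_pow, ← pow_mul, pow_add]
  ring

theorem formA_pow (A B : ℂ) (n : ℕ) :
    (A ^ 5 - 3 * A ^ 4 * B + 4 * A ^ 3 * B ^ 2 - 2 * A ^ 2 * B ^ 3 + A * B ^ 4) ^ n =
      ∑ v ∈ compositions n, (-1) ^ (v 1 + v 3) * 2 ^ v 3 * 3 ^ v 1 * 4 ^ v 2 *
        (Nat.multinomial Finset.univ v : ℂ) * (A ^ fWeight v * B ^ gWeight v) := by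
  have h := Finset.sum_pow_eq_sum_piAntidiag Finset.univ
    ![A ^ 5, (-1) * 3 * A ^ 4 * B, 4 * A ^ 3 * B ^ 2, (-1) * 2 * A ^ 2 * B ^ 3, A * B ^ 4] n
  simp only [Fin.sum_univ_five, Fin.prod_univ_five] at h
  refine Eq.trans ?_ (h.trans (Finset.sum_congr rfl fun v _ => ?_))
  · simp only [Matrix.cons_val]
    ring
  · simp only [fWeight, gWeight, Matrix.cons_val]
    simp only [mul_pow, ← pow_mul, pow_add]
    ring

/-- Each pair of compositions contributes to the single row given by its exponent of `A`; the
condition on the exponent of `B` is then automatic, as the total degree is `5d`. -/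
theorem sum_pentamidiation_mul (d : ℕ) (k : Fin (d + 1)) (A B : ℂ) :
    ∑ r : Fin (5 * d + 1), (pentamidiation d r k : ℂ) * (A ^ (r : ℕ) * B ^ (5 * d - (r : ℕ))) =
      (A ^ 5 - 3 * A ^ 4 * B + 4 * A ^ 3 * B ^ 2 - 2 * A ^ 2 * B ^ 3 + A * B ^ 4) ^ (k : ℕ) *
      (B ^ 5 + 3 * A * B ^ 4 + 4 * A ^ 2 * B ^ 3 + 2 * A ^ 3 * B ^ 2 + A ^ 4 * B) ^
        (d - (k : ℕ)) := by
  rw [formA_pow, formB_pow]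
  refine Eq.trans ?_ (mul_comm _ _)
  rw [Finset.sum_mul_sum, ← Finset.sum_product']
  simp only [pentamidiation, Matrix.of_apply, Int.cast_sum, Finset.sum_mul, Finset.sum_filter]
  rw [Finset.sum_comm]
  refine Finset.sum_congr rfl fun p hp => ?_
  rw [Finset.mem_product] at hp
  have h1 := fWeight_add_gWeight hp.1
  have h2 := fWeight_add_gWeight hp.2
  have hk := k.isLt
  have hr : gWeight p.1 + fWeight p.2 < 5 * d + 1 := by omega
  rw [Finset.sum_eq_single (⟨gWeight p.1 + fWeight p.2, hr⟩ : Fin (5 * d + 1))]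
  · rw [if_pos ⟨by simp only; omega, rfl⟩,
      (by simp only; omega : 5 * d - ((⟨gWeight p.1 + fWeight p.2, hr⟩ : Fin (5 * d + 1)) : ℕ) =
        fWeight p.1 + gWeight p.2)]
    push_cast
    simp only [pow_add]
    ring
  · intro r _ hne
    rw [if_neg fun h => hne (Fin.ext h.2.symm)]
    simp
  · simp

/-- The expansion of `F(q^{1/5})`, with `x = q^{1/5}`. -/
theorem formFun_eq_sum (d : ℕ) (a : Fin (d + 1) → ℂ) {x : ℂ} (hx : ‖x‖ < 1) :
    formFun d a x = ∑ r : Fin (5 * d + 1),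
      pentamidiate d a r * thetaA x ^ (r : ℕ) * thetaB x ^ (5 * d - (r : ℕ)) := by
  -- The quintic identities relate `y` to `y^5`, so a fifth root of `x` is needed; any choice works.
  obtain ⟨y, rfl⟩ := IsAlgClosed.exists_pow_nat_eq x (n := 5) (by norm_num)
  have hy : ‖y‖ < 1 := by
    rw [norm_pow] at hx
    exact (pow_lt_one_iff_of_nonneg (norm_nonneg y) (by norm_num)).1 hx
  obtain ⟨hA, hB⟩ := pow_five_eq hy
  rw [← form_eq_formFun, form]
  simp only [pow_mul _ 5, hA, hB, mul_assoc (a _), ← sum_pentamidiation_mul]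
  simp only [pentamidiate, Matrix.mulVec, dotProduct, Matrix.map_apply, Finset.mul_sum,
    Finset.sum_mul]
  rw [Finset.sum_comm]
  exact Finset.sum_congr rfl fun r _ => Finset.sum_congr rfl fun k _ => by ring

/-! ### Multisection by averaging over fifth roots of unity. -/

theorem sum_root_pow {ζ : ℂ} (hζ : IsPrimitiveRoot ζ 5) (n : ℕ) :
    ∑ j ∈ Finset.range 5, (ζ ^ j) ^ n = if 5 ∣ n then 5 else 0 := by
  have h : ∀ j : ℕ, (ζ ^ j) ^ n = (ζ ^ n) ^ j := fun j => by rw [← pow_mul, ← pow_mul, mul_comm]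
  simp only [h]
  split_ifs with h5
  · simp [(hζ.pow_eq_one_iff_dvd n).2 h5]
  · exact (hζ.pow_of_coprime n
      ((Nat.Prime.coprime_iff_not_dvd Nat.prime_five).2 h5).symm).geom_sum_eq_zero (by norm_num)

/-- Multisection of a power series by averaging over the fifth roots of unity. -/
theorem sumsTo_multisection {f : ℂ⟦X⟧} {F : ℂ → ℂ} {ζ x : ℂ} (hζ : IsPrimitiveRoot ζ 5)
    (hf : ∀ j < 5, SumsTo f (ζ ^ j * x) (F (ζ ^ j * x))) {m : ℕ} (hm : m < 5)
    (hx : m ≠ 0 → x ≠ 0) :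
    SumsTo (multisection m f) (x ^ 5) (x ^ (-(m : ℤ)) *
      (5⁻¹ * ∑ j ∈ Finset.range 5, (ζ ^ j) ^ (5 - m) * F (ζ ^ j * x))) := by
  -- The weight `ζ^(j(5-m))` stands for `ζ^(-jm)` with a natural exponent; it selects `n ≡ m` modulo
  -- 5.
  have h1 : HasSum (fun n => ∑ j ∈ Finset.range 5,
      (ζ ^ j) ^ (5 - m) * (PowerSeries.coeff n f * (ζ ^ j * x) ^ n))
      (∑ j ∈ Finset.range 5, (ζ ^ j) ^ (5 - m) * F (ζ ^ j * x)) :=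
    hasSum_sum fun j hj => (hf j (Finset.mem_range.1 hj)).mul_left _
  have h2 : ∀ n, ∑ j ∈ Finset.range 5,
      (ζ ^ j) ^ (5 - m) * (PowerSeries.coeff n f * (ζ ^ j * x) ^ n) =
      PowerSeries.coeff n f * x ^ n * if 5 ∣ n + (5 - m) then 5 else 0 := fun n => by
    rw [← sum_root_pow hζ, Finset.mul_sum]
    refine Finset.sum_congr rfl fun j _ => ?_
    rw [mul_pow (ζ ^ j) x, pow_add]
    ring
  simp only [h2] at h1
  have hi : Function.Injective fun n : ℕ => 5 * n + m := fun a b h => by simp only at h; omega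
  have h3 := ((hi.hasSum_iff fun n hn => ?_).2 h1).mul_left (x ^ (-(m : ℤ)) * 5⁻¹)
  · rw [mul_assoc] at h3
    refine h3.congr_fun fun n => ?_
    have hd : 5 ∣ 5 * n + m + (5 - m) := ⟨n + 1, by omega⟩
    have hc : x ^ (-(m : ℤ)) * x ^ m = 1 := by
      rcases eq_or_ne m 0 with rfl | h
      · simp
      · rw [zpow_neg, zpow_natCast]
        exact inv_mul_cancel₀ (pow_ne_zero _ (hx h))
    rw [multisection, PowerSeries.coeff_mk, Function.comp_apply, if_pos hd, pow_add, pow_mul]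
    linear_combination (-PowerSeries.coeff (5 * n + m) f * (x ^ 5) ^ n) * hc
  · have : ¬ 5 ∣ n + (5 - m) := fun hd => hn <| by
      obtain ⟨k, hk⟩ := hd
      exact ⟨k - 1, by simp only; omega⟩
    rw [if_neg this, mul_zero]

/-- The term of index `r` is multiplied by `ζ^(jr)` under `x ↦ ζ^j x`, so only `r ≡ m` survives.
Leaving the length `n` free serves both `d + 1 - χ(m)` and, for the Hecke operator, `d + 1`. -/
theorem average_formFun (d : ℕ) (a : Fin (d + 1) → ℂ) {ζ x : ℂ} (hζ : IsPrimitiveRoot ζ 5)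
    (hx : ‖x‖ < 1) {m n : ℕ} (hm : m < 5) (hlt : ∀ k : Fin n, 5 * (k : ℕ) + m < 5 * d + 1)
    (hmem : ∀ k : ℕ, 5 * k + m < 5 * d + 1 → k < n) :
    5⁻¹ * ∑ j ∈ Finset.range 5, (ζ ^ j) ^ (5 - m) * formFun d a (ζ ^ j * x) =
      ∑ k : Fin n, pentamidiate d a ⟨5 * (k : ℕ) + m, hlt k⟩ * thetaA x ^ (5 * (k : ℕ) + m) *
        thetaB x ^ (5 * d - 5 * (k : ℕ) - m) := by
  have hn : ‖ζ‖ = 1 := Complex.norm_eq_one_of_pow_eq_one hζ.pow_eq_one (by norm_num)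
  have hj : ∀ j : ℕ, (ζ ^ j) ^ (5 - m) * formFun d a (ζ ^ j * x) =
      ∑ r : Fin (5 * d + 1), pentamidiate d a r * thetaA x ^ (r : ℕ) *
        thetaB x ^ (5 * d - (r : ℕ)) * (ζ ^ j) ^ ((r : ℕ) + (5 - m)) := fun j => by
    have h5 : (ζ ^ j) ^ 5 = 1 := by rw [← pow_mul, mul_comm, pow_mul, hζ.pow_eq_one, one_pow]
    rw [formFun_eq_sum d a (by rwa [norm_mul, norm_pow, hn, one_pow, one_mul]),
      thetaA_mul_of_pow_five h5, thetaB_mul_of_pow_five h5, Finset.mul_sum]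
    refine Finset.sum_congr rfl fun r _ => ?_
    rw [mul_pow, pow_add]
    ring
  simp only [hj]
  rw [Finset.sum_comm]
  simp only [← Finset.mul_sum, sum_root_pow hζ]
  rw [Finset.mul_sum]
  symm
  refine Finset.sum_of_injOn (fun k : Fin n => (⟨5 * (k : ℕ) + m, hlt k⟩ : Fin (5 * d + 1)))
    (fun k _ l _ h => ?_) (fun _ _ => Finset.mem_coe.2 (Finset.mem_univ _)) (fun r _ hr => ?_)
    fun k _ => ?_
  · have := Fin.ext_iff.1 h
    simp only at this
    exact Fin.ext (by omega)
  · rw [if_neg, mul_zero, mul_zero]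
    rintro ⟨k, hk⟩
    refine hr ?_
    have hrl := r.isLt
    exact ⟨⟨k - 1, hmem _ (by omega)⟩, Finset.mem_coe.2 (Finset.mem_univ _),
      Fin.ext (by simp only; omega)⟩
  · rw [if_pos ⟨(k : ℕ) + 1, by simp only; omega⟩, ← Nat.sub_sub]
    ring

theorem sum_heckeMatrix (d : ℕ) (a : Fin (d + 1) → ℂ) (x : ℂ)
    (hlt : ∀ k : Fin (d + 1), 5 * (k : ℕ) + 0 < 5 * d + 1) :
    ∑ k : Fin (d + 1), pentamidiate d a ⟨5 * (k : ℕ) + 0, hlt k⟩ * thetaA x ^ (5 * (k : ℕ) + 0) *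
        thetaB x ^ (5 * d - 5 * (k : ℕ) - 0) =
      form d (((heckeMatrix d).map (Int.cast : ℤ → ℂ)).mulVec a) x := by
  simp only [form, Nat.mul_sub]
  rfl

/-! ### The Hecke operator. -/

theorem norm_qRoot_lt_one (τ : UpperHalfPlane) : ‖qRoot τ‖ < 1 := by
  rw [qRoot, Function.Periodic.norm_qParam, Real.exp_lt_one_iff]
  have := τ.im_pos
  have hpi := Real.pi_pos
  have : 0 < 2 * Real.pi * (τ : ℂ).im / 5 := by
    have : 0 < (τ : ℂ).im := τ.im_pos
    positivity
  linarith

/-- The representative sends `τ` to `(τ + j)/5`, so the five values of `q` there are the five fifth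
roots of `exp (2πiτ)`. -/
theorem qRoot_smul_pow_five (j : Fin 5) (τ : UpperHalfPlane) :
    qRoot (heckeRep j • τ) ^ 5 =
      Complex.exp (2 * Real.pi * Complex.I / (5 : ℕ)) ^ (j : ℕ) * qRoot τ := by
  have hdet : (heckeRep j).det.val = 5 := by simp [heckeRep, Matrix.det_fin_two]
  have hc : ((heckeRep j • τ : UpperHalfPlane) : ℂ) = ((τ : ℂ) + (j : ℕ)) / 5 := by
    rw [UpperHalfPlane.coe_smul_of_det_pos (by rw [hdet]; norm_num)]
    simp [UpperHalfPlane.num, UpperHalfPlane.denom, heckeRep]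
  rw [qRoot, qRoot, hc, Function.Periodic.qParam, Function.Periodic.qParam, ← Complex.exp_nat_mul,
    ← Complex.exp_nat_mul, ← Complex.exp_add]
  congr 1
  push_cast
  field_simp
  ring

theorem heckeT5_apply (d : ℕ) (F : UpperHalfPlane → ℂ) (τ : UpperHalfPlane) :
    heckeT5 (d : ℤ) F τ = 5⁻¹ * ∑ j : Fin 5, F (heckeRep j • τ) := by
  rw [heckeT5, Finset.sum_apply, Finset.mul_sum]
  refine Finset.sum_congr rfl fun j _ => ?_
  have hdet : (heckeRep j).det.val = 5 := by simp [heckeRep, Matrix.det_fin_two]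
  have hden : UpperHalfPlane.denom (heckeRep j) τ = 5 := by
    simp [UpperHalfPlane.denom, heckeRep]
  rw [ModularForm.slash_apply, hden, hdet, UpperHalfPlane.σ, if_pos (by rw [hdet]; norm_num),
    abs_of_pos (by norm_num), mul_assoc]
  push_cast
  -- The determinant gives `5^(d-1)` and the denominator `5^(-d)`, leaving `1/5` in every weight.
  rw [← zpow_add₀ (by norm_num), (by ring : (d : ℤ) - 1 + -d = -1), zpow_neg_one, mul_comm]
  rfl

theorem heckeT5_form (d : ℕ) (a : Fin (d + 1) → ℂ) (τ : UpperHalfPlane) :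
    heckeT5 (d : ℤ) (fun σ => form d a (qRoot σ)) τ =
      form d (((heckeMatrix d).map (Int.cast : ℤ → ℂ)).mulVec a) (qRoot τ) := by
  have hζ : IsPrimitiveRoot (Complex.exp (2 * Real.pi * Complex.I / (5 : ℕ))) 5 :=
    Complex.isPrimitiveRoot_exp 5 (by norm_num)
  rw [← sum_heckeMatrix d a _ fun k => by omega, ← average_formFun d a hζ (norm_qRoot_lt_one τ)
    (by norm_num) _ fun k hk => by omega, heckeT5_apply, Finset.sum_range]
  congr 1
  refine Finset.sum_congr rfl fun j _ => ?_
  rw [form_eq_formFun, qRoot_smul_pow_five, Nat.sub_zero, ← pow_mul, mul_comm (j : ℕ), pow_mul,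
    hζ.pow_eq_one, one_pow, one_mul]

end Quintic

theorem theorem1p2 (d : ℕ) (a : Fin (d + 1) → ℂ) :
    ∃ f : PowerSeries ℂ,
      (∀ x : ℂ, ‖x‖ < 1 → Quintic.SumsTo f (x ^ 5) (Quintic.form d a x)) ∧
      (∀ x : ℂ, ‖x‖ < 1 →
        Quintic.SumsTo f x
          (∑ r : Fin (5 * d + 1), Quintic.pentamidiate d a r *
            Quintic.thetaA x ^ (r : ℕ) * Quintic.thetaB x ^ (5 * d - (r : ℕ)))) ∧
      (∀ (m : Fin 5) (x : ℂ), ‖x‖ < 1 → ((m : ℕ) ≠ 0 → x ≠ 0) →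
        Quintic.SumsTo (Quintic.multisection m f) (x ^ 5)
          (x ^ (-((m : ℕ) : ℤ)) *
            ∑ k : Fin (d + 1 - Quintic.chi m),
              Quintic.pentamidiate d a ⟨5 * (k : ℕ) + (m : ℕ), Quintic.index_lt d m k⟩ *
                Quintic.thetaA x ^ (5 * (k : ℕ) + (m : ℕ)) *
                Quintic.thetaB x ^ (5 * d - 5 * (k : ℕ) - (m : ℕ)))) ∧
      (∀ τ : UpperHalfPlane,
        Quintic.heckeT5 (d : ℤ) (fun σ => Quintic.form d a (Quintic.qRoot σ)) τ =
            Quintic.form d (((Quintic.heckeMatrix d).map (Int.cast : ℤ → ℂ)).mulVec a)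
              (Quintic.qRoot τ) ∧
          Quintic.SumsTo (Quintic.multisection 0 f) (Quintic.qRoot τ ^ 5)
            (Quintic.heckeT5 (d : ℤ) (fun σ => Quintic.form d a (Quintic.qRoot σ)) τ)) := by
  obtain ⟨f, hf⟩ := Quintic.exists_powerSeries d a
  have hζ : IsPrimitiveRoot (Complex.exp (2 * Real.pi * Complex.I / (5 : ℕ))) 5 :=
    Complex.isPrimitiveRoot_exp 5 (by norm_num)
  have hn := Complex.norm_eq_one_of_pow_eq_one hζ.pow_eq_one (by norm_num)
  have hroots : ∀ x : ℂ, ‖x‖ < 1 → ∀ j < 5, Quintic.SumsTo f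
      (Complex.exp (2 * Real.pi * Complex.I / (5 : ℕ)) ^ j * x)
      (Quintic.formFun d a (Complex.exp (2 * Real.pi * Complex.I / (5 : ℕ)) ^ j * x)) :=
    fun x hx j _ => hf _ (by rwa [norm_mul, norm_pow, hn, one_pow, one_mul])
  refine ⟨f, fun x hx => ?_, fun x hx => ?_, fun m x hx hm => ?_, fun τ => ⟨?_, ?_⟩⟩
  · rw [Quintic.form_eq_formFun]
    exact hf _ (Quintic.norm_pow_five_lt_one hx)
  · rw [← Quintic.formFun_eq_sum d a hx]
    exact hf x hx
  · have h := Quintic.sumsTo_multisection hζ (hroots x hx) m.isLt hm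
    rwa [Quintic.average_formFun d a hζ hx m.isLt (Quintic.index_lt d m) fun k hk => ?_] at h
    have hχ : ∀ m : Fin 5, Quintic.chi m = if (m : ℕ) = 0 then 0 else 1 := by decide
    have := hχ m
    split_ifs at this <;> omega
  · exact Quintic.heckeT5_form d a τ
  · have hx := Quintic.norm_qRoot_lt_one τ
    have h := Quintic.sumsTo_multisection (m := 0) hζ (hroots _ hx) (by norm_num)
      fun h => absurd rfl h
    rw [Quintic.average_formFun d a hζ hx (by norm_num) (fun k : Fin (d + 1) => by omega)
      fun k hk => by omega, Quintic.sum_heckeMatrix] at h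
    rw [Quintic.heckeT5_form]
    simpa using h
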